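/- **Setting.** There are $m\ge 1$ sources. Packets are sent one at a time over a channel with i.i.d. service times $Y_1,Y_2,\dots$ that take values in a finite set $\mathcal Y\subset[0,\infty)$ and satisfy $\mathbb E[Y_1]>0$; let $Y$ have the same law. Put $D_0=0$. After the $i$-th delivery, at time $D_i$, a decision maker chooses, as a function of $Y_1,\dots,Y_i$, a source $r_{i+1}$ (the scheduler $\pi$) and a waiting time $Z_i\in\mathcal Z$ (the sampler $f$), where $\mathcal Z\subset[0,\infty)$ is finite and $0\in\mathcal Z$. Packet $i+1$ is generated from source $r_{i+1}$ at $S_{i+1}=D_i+Z_i$ and delivered at $D_{i+1}=S_{i+1}+Y_{i+1}$. The age $\Delta_l(t)$ of source $l$ is $t$ minus the largest generation time of the packets of source $l$ delivered by time $t$; before its first delivery it is $t$ plus a given initial age, which is $\ge 0$. Let $g:[0,\infty)\to\mathbb R$ be non-decreasing. The optimal total-average age-penalty per unit time (Ta-AP) is $$\bar\Delta=\inf_{\pi,f}\ \limsup_{n\to\infty}\frac{\mathbb E\big[\sum_{l=1}^m\int_0^{D_n}g(\Delta_l(t))\,dt\big]}{\mathbb E[D_n]} .$$ **Sampling problem under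 maximum-age-first scheduling.** The state is the vector $\mathbf s=(a_{[1]},\dots,a_{[m]})$ of the ages at a delivery time in decreasing order. If the waiting time is $z$ and the service time is $y$, the next state $\mathbf s'(z,y)$ has the entries $a'_{[l]}=a_{[l+1]}+z+y$ for $l<m$ and $a'_{[m]}=y$. Let $\mathcal S$ be the finite set of the states that can be reached from the sorted vector of initial ages with $z\in\mathcal Z$, $y\in\mathcal Y$. Put $$C(\mathbf s,z)=\mathbb E_Y\Big[\sum_{l=1}^m\int_{a_{[l]}}^{a_{[l]}+z+Y}g(\tau)\,d\tau-\bar\Delta\,(z+Y)\Big],\qquad J_\alpha(\mathbf s)=\inf_f\limsup_{n\to\infty}\mathbb E\Big[\sum_{i=0}^{n-1}\alpha^iC(\mathbf s(i),Z_i)\Big]\quad(\mathbf s(0)=\mathbf s),$$ for $0<\alpha<1$, the infimum being over all causal samplers. **Proposition.** Let $\mathbf o\in\mathcal S$. The limits $h(\mathbf s)=\lim_{\alpha\to1^-}(J_\alpha(\mathbf s)-J_\alpha(\mathbf o))$ exist for all $\mathbf s\in\mathcal S$, and for some $\lambda\in\mathbb R$ Bellman's equation $$\lambda+h(\mathbf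 s)=\min_{z\in\mathcal Z}\Big(C(\mathbf s,z)+\mathbb E_Y\big[h(\mathbf s'(z,Y))\big]\Big),\qquad \mathbf s\in\mathcal S,$$ holds. If $\mathbf s=(a_{[1]},\dots,a_{[m]})\in\mathcal S$ satisfies $$\mathbb E_Y\Big[\sum_{l=1}^m g(a_{[l]}+Y)\Big]\ge\bar\Delta ,$$ then zero is an optimal waiting time in state $\mathbf s$: $z=0$ attains the minimum in Bellman's equation at $\mathbf s$. Moreover, there is a decision rule $q:\mathbb R^m\to\mathcal Z$ such that $q(\mathbf s)$ attains the minimum in Bellman's equation at every $\mathbf s\in\mathcal S$, $q(\mathbf s)=0$ at every $\mathbf s\in\mathcal S$ that satisfies the inequality above, and, from every initial state in $\mathcal S$, the stationary deterministic sampler $Z_i=q(\mathbf s(i))$ minimizes the average cost per stage $\limsup_{n\to\infty}\frac1n\mathbb E\big[\sum_{i=0}^{n-1}C(\mathbf s(i),Z_i)\big]$ over all causal samplers. -/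

import Mathlib

open MeasureTheory ProbabilityTheory Filter Topology

noncomputable section

namespace StatusUpdate

/-- A status update system with `m` sources. Packet `i + 1` has service time `Y i`; the service
times are i.i.d. with values in a finite set `serviceTimes`, and waiting times are chosen from a
finite set `waitingTimes`. Only the values of the age-penalty function `g` on `[0, ∞)` matter. -/
structure System (Ω : Type*) [MeasurableSpace Ω] (m : ℕ) where
  sources_pos : 0 < m
  g : ℝ → ℝ
  g_mono : MonotoneOn g (Set.Ici 0)
  waitingTimes : Finset ℝ
  waiting_nonneg : ∀ z ∈ waitingTimes, 0 ≤ z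
  zero_mem : (0 : ℝ) ∈ waitingTimes
  serviceTimes : Finset ℝ
  service_nonneg : ∀ y ∈ serviceTimes, 0 ≤ y
  μ : Measure Ω
  isProb : IsProbabilityMeasure μ
  Y : ℕ → Ω → ℝ
  Y_meas : ∀ i, Measurable (Y i)
  Y_mem : ∀ i ω, Y i ω ∈ serviceTimes
  Y_indep : iIndepFun Y μ
  Y_ident : ∀ i, IdentDistrib (Y i) (Y 0) μ μ
  Y_mean_pos : 0 < ∫ ω, Y 0 ω ∂μ
  initAge : Fin m → ℝ
  initAge_nonneg : ∀ l, 0 ≤ initAge l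

/-- The first `i` service times, i.e. what has been observed at the `i`-th delivery time. -/
def hist (y : ℕ → ℝ) (i : ℕ) : Fin i → ℝ := fun j => y j

/-- A causal sampler: the waiting time after the `i`-th delivery is a function of the first `i`
service times. -/
abbrev Sampler (𝒵 : Finset ℝ) : Type := (i : ℕ) → (Fin i → ℝ) → 𝒵

/-- A causal scheduler: the source of packet `i + 1`, chosen at the `i`-th delivery time. -/
abbrev Scheduler (m : ℕ) : Type := (i : ℕ) → (Fin i → ℝ) → Fin m

/-- `deliveryTime f y i` is the delivery time `D_i` of packet `i` (and `D_0 = 0`), when the service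
times are `y 0, y 1, …`. -/
def deliveryTime {𝒵 : Finset ℝ} (f : Sampler 𝒵) (y : ℕ → ℝ) : ℕ → ℝ
  | 0 => 0
  | i + 1 => deliveryTime f y i + (f i (hist y i) : ℝ) + y i

/-- `generationTime f y i` is the generation time of packet `i + 1`. -/
def generationTime {𝒵 : Finset ℝ} (f : Sampler 𝒵) (y : ℕ → ℝ) (i : ℕ) : ℝ :=
  deliveryTime f y i + (f i (hist y i) : ℝ)

/-- The sorted age vector at delivery times; the entry with index `l` is the `(l + 1)`-th
largest age. -/
abbrev State (m : ℕ) : Type := Fin m → ℝ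

/-- One step of the sorted age vector under the maximum-age-first scheduler, with waiting time `z`
and service time `y`: the largest age is replaced by `y`, which becomes the smallest one. -/
def next {m : ℕ} (s : State m) (z y : ℝ) : State m := fun l =>
  if h : (l : ℕ) + 1 < m then s ⟨(l : ℕ) + 1, h⟩ + z + y else y

/-- The state at stage `i`, starting from `s`, under the sampler `f`. -/
def stateAt {m : ℕ} {𝒵 : Finset ℝ} (f : Sampler 𝒵) (s : State m) (y : ℕ → ℝ) : ℕ → State m
  | 0 => s
  | i + 1 => next (stateAt f s y i) (f i (hist y i) : ℝ) (y i)

/-- The state after `i` stages, starting from `s`, when the waiting time is always `q` of the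
current state and the service times so far are `v`. -/
def closedLoopState {m : ℕ} {𝒵 : Finset ℝ} (q : State m → 𝒵) (s : State m) :
    (i : ℕ) → (Fin i → ℝ) → State m
  | 0, _ => s
  | i + 1, v =>
      next (closedLoopState q s i fun j => v j.castSucc)
        (q (closedLoopState q s i fun j => v j.castSucc) : ℝ) (v (Fin.last i))

/-- The stationary deterministic sampler with decision rule `q`, started in `s`. -/
def stationarySampler {m : ℕ} {𝒵 : Finset ℝ} (q : State m → 𝒵) (s : State m) : Sampler 𝒵 :=
  fun i v => q (closedLoopState q s i v)

namespace System

variable {Ω : Type*} [MeasurableSpace Ω] {m : ℕ} (M : System Ω m)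

/-- The service times along the outcome `ω`. -/
def path (ω : Ω) : ℕ → ℝ := fun i => M.Y i ω

/-- Generation time of the freshest packet of source `l` delivered by time `t`; before the first
delivery from `l` this is minus the initial age. -/
def freshest (r : Scheduler m) (f : Sampler M.waitingTimes) (y : ℕ → ℝ) (l : Fin m) (t : ℝ) : ℝ :=
  sSup ({-M.initAge l} ∪
    {u | ∃ i, r i (hist y i) = l ∧ deliveryTime f y (i + 1) ≤ t ∧ u = generationTime f y i})

/-- The age of source `l` at time `t`. -/
def age (r : Scheduler m) (f : Sampler M.waitingTimes) (y : ℕ → ℝ) (l : Fin m) (t : ℝ) : ℝ :=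
  t - M.freshest r f y l t

/-- The total age-penalty accumulated by all sources over `[0, D_n]`. -/
def totalPenalty (r : Scheduler m) (f : Sampler M.waitingTimes) (y : ℕ → ℝ) (n : ℕ) : ℝ :=
  ∑ l, ∫ t in (0 : ℝ)..(deliveryTime f y n), M.g (M.age r f y l t)

/-- The total-average age-penalty per unit time (Ta-AP) of a decision policy. It may be `⊤`, for
instance if some source is never served. -/
def taAP (r : Scheduler m) (f : Sampler M.waitingTimes) : EReal :=
  limsup (fun n : ℕ =>
    (((∫ ω, M.totalPenalty r f (M.path ω) n ∂M.μ) /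
      (∫ ω, deliveryTime f (M.path ω) n ∂M.μ) : ℝ) : EReal)) atTop

/-- The optimal Ta-AP over all causal schedulers and samplers. The infimum is finite: it is at least
`m * g 0`, and cyclic service without waiting has a finite Ta-AP. -/
def optTaAP : ℝ :=
  (⨅ (r : Scheduler m) (f : Sampler M.waitingTimes), M.taAP r f).toReal

/-- The initial state: the initial ages in decreasing order. -/
def initState : State m := M.initAge ∘ Tuple.sort (fun l => -M.initAge l)

/-- The state space: all states that can occur. -/
inductive IsState : State m → Prop
  | init : IsState M.initState
  | step {s : State m} {z y : ℝ} : IsState s → z ∈ M.waitingTimes → y ∈ M.serviceTimes →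
      IsState (next s z y)

/-- The expected cost `C(s, z)` of a stage. -/
def cost (s : State m) (z : ℝ) : ℝ :=
  ∫ ω, ((∑ l, ∫ τ in (s l)..(s l + z + M.Y 0 ω), M.g τ) - M.optTaAP * (z + M.Y 0 ω)) ∂M.μ

/-- The expected `α`-discounted cost of the first `n` stages. -/
def discountedCost (α : ℝ) (s : State m) (f : Sampler M.waitingTimes) (n : ℕ) : ℝ :=
  ∫ ω, ∑ i ∈ Finset.range n,
    α ^ i * M.cost (stateAt f s (M.path ω) i) (f i (hist (M.path ω) i)) ∂M.μ

/-- The optimal total expected `α`-discounted cost `J_α(s)`. -/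
def optDiscounted (α : ℝ) (s : State m) : ℝ :=
  ⨅ f : Sampler M.waitingTimes, limsup (fun n => M.discountedCost α s f n) atTop

/-- The average cost per stage of the sampler `f` from the initial state `s`. -/
def averageCost (s : State m) (f : Sampler M.waitingTimes) : ℝ :=
  limsup (fun n : ℕ => (1 / (n : ℝ)) * ∫ ω, ∑ i ∈ Finset.range n,
    M.cost (stateAt f s (M.path ω) i) (f i (hist (M.path ω) i)) ∂M.μ) atTop

/-- `f` minimizes the average cost per stage from the initial state `s`. -/
def IsAverageOptimal (s : State m) (f : Sampler M.waitingTimes) : Prop :=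
  ∀ f' : Sampler M.waitingTimes, M.averageCost s f ≤ M.averageCost s f'

/-- The right-hand side of Bellman's equation before minimization: the cost of the stage plus the
expected value of `h` at the next state. -/
def bellman (h : State m → ℝ) (s : State m) (z : ℝ) : ℝ :=
  M.cost s z + ∫ ω, h (next s z (M.Y 0 ω)) ∂M.μ

/-- `h` is the relative cost function with reference state `o`. -/
def IsRelativeCost (o : State m) (h : State m → ℝ) : Prop :=
  ∀ s, M.IsState s →
    Tendsto (fun α : ℝ => M.optDiscounted α s - M.optDiscounted α o) (𝓝[<] 1) (𝓝 (h s))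

/-- `(lam, h)` solves Bellman's equation of the average cost problem. -/
def SolvesBellman (lam : ℝ) (h : State m → ℝ) : Prop :=
  ∀ s, M.IsState s → IsLeast (M.bellman h s '' (M.waitingTimes : Set ℝ)) (lam + h s)

/-- `z` is an optimal waiting time in state `s`: it attains the minimum in Bellman's equation. -/
def IsOptimalWait (h : State m → ℝ) (s : State m) (z : ℝ) : Prop :=
  z ∈ M.waitingTimes ∧ ∀ z' ∈ M.waitingTimes, M.bellman h s z ≤ M.bellman h s z'

/-- The threshold condition: with zero waiting, the expected total age-penalty just before the next
delivery is at least the optimal Ta-AP. -/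
def PassesThreshold (s : State m) : Prop :=
  M.optTaAP ≤ ∫ ω, ∑ l, M.g (s l + M.Y 0 ω) ∂M.μ

end System

end StatusUpdate

end

/-!
The sampling problem is a Markov decision process with finitely many states and actions: each entry
of a state is a sum of at most `m` waiting times, `m` service times and possibly one initial age.

*Discounted problem.* The discounted Bellman operator is a contraction, and its fixed point is
`optDiscounted α`, attained by a stationary decision rule (`optDiscounted_bellman`). The same
causal sampler, run from two initial states, yields ordered states if the initial states are
ordered, and equal states after `m` stages. Hence `optDiscounted α` is monotone in the state
(`optDiscounted_mono`), and its differences are bounded uniformly in `α`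
(`exists_bound_optDiscounted_sub`).

*Existence of the relative cost.* Solutions of the average cost Bellman equation need not be unique
up to constants, so compactness in `α` does not give convergence. Instead, by Cramer's rule the
discounted cost of each stationary rule is meromorphic in `α` at `1`, and two such functions are
comparable on an interval `(1 - ε, 1)`. As there are finitely many rules, `optDiscounted α s` agrees
near `1` with a meromorphic function, for each `s` (`exists_meromorphicAt_optDiscounted`). A
difference of two of these is bounded, so it has no pole and converges (`exists_isRelativeCost`).
Bellman's equation follows by passing to the limit (`IsRelativeCost.exists_solvesBellman`).

*Threshold.* Above the threshold, waiting does not lower the cost of the stage, because `g` is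
monotone (`cost_zero_le`), nor the relative cost of the next state, because `h` is monotone. So zero
waiting attains the minimum (`IsRelativeCost.isOptimalWait_zero`).

*Average cost.* Telescoping Bellman's equation along a trajectory shows that every causal sampler
has average cost at least `lam` (`le_averageCost`), with equality for a stationary rule that
attains the minima (`averageCost_stationary`).
-/

namespace StatusUpdate

/-! ### Integrals of finitely valued random variables -/

/-- `X` takes finitely many values, each on a measurable set. Every function of such an `X` is
again of this kind, so that no measurability of samplers or decision rules is needed. -/
def FiniteValued {Ω β : Type*} [MeasurableSpace Ω] (X : Ω → β) : Prop :=
  (Set.range X).Finite ∧ ∀ t, MeasurableSet (X ⁻¹' {t})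

namespace FiniteValued

variable {Ω β γ : Type*} [MeasurableSpace Ω] {X : Ω → β} {Z : Ω → γ}

lemma measurableSet_preimage (hX : FiniteValued X) (A : Set β) : MeasurableSet (X ⁻¹' A) := by
  rw [← Set.preimage_inter_range, ← Set.biUnion_of_singleton (A ∩ Set.range X),
    Set.preimage_iUnion₂]
  exact (hX.1.subset Set.inter_subset_right).measurableSet_biUnion fun t _ => hX.2 t

lemma comp (hX : FiniteValued X) (φ : β → γ) : FiniteValued fun ω => φ (X ω) :=
  ⟨by simpa [Set.range_comp'] using hX.1.image φ, fun t => hX.measurableSet_preimage (φ ⁻¹' {t})⟩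

lemma measurable [MeasurableSpace β] (hX : FiniteValued X) : Measurable X :=
  fun A _ => hX.measurableSet_preimage A

lemma prodMk (hX : FiniteValued X) (hZ : FiniteValued Z) : FiniteValued fun ω => (X ω, Z ω) := by
  refine ⟨(hX.1.prod hZ.1).subset ?_, fun t => ?_⟩
  · rintro _ ⟨ω, rfl⟩
    exact ⟨⟨ω, rfl⟩, ⟨ω, rfl⟩⟩
  · have : (fun ω => (X ω, Z ω)) ⁻¹' {t} = X ⁻¹' {t.1} ∩ Z ⁻¹' {t.2} := by
      ext ω
      simp [Prod.ext_iff]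
    rw [this]
    exact (hX.2 _).inter (hZ.2 _)

lemma integrable {μ : Measure Ω} [IsFiniteMeasure μ] {F : Ω → ℝ} (hF : FiniteValued F) :
    Integrable F μ := by
  obtain ⟨B, hB⟩ := hF.1.isBounded.exists_norm_le
  exact Integrable.of_bound hF.measurable.aestronglyMeasurable B
    (Eventually.of_forall fun ω => hB _ ⟨ω, rfl⟩)

lemma integral_eq_sum {μ : Measure Ω} [IsFiniteMeasure μ] (hX : FiniteValued X) {T : Finset β}
    (hT : ∀ ω, X ω ∈ T) (F : β → ℝ) :
    ∫ ω, F (X ω) ∂μ = ∑ t ∈ T, μ.real (X ⁻¹' {t}) * F t := by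
  classical
  have h1 : ∀ ω, F (X ω) = ∑ t ∈ T, (X ⁻¹' {t}).indicator (fun _ => F t) ω := by
    intro ω
    rw [Finset.sum_eq_single (X ω)]
    · simp
    · intro t _ ht
      simp [Set.indicator, ht.symm]
    · exact fun h => (h (hT ω)).elim
  simp_rw [h1]
  rw [integral_finsetSum _ fun t _ => (integrable_const _).indicator (hX.2 t)]
  exact Finset.sum_congr rfl fun t _ => by rw [integral_indicator_const _ (hX.2 t), smul_eq_mul]

/-- Fubini's theorem for a pair of independent variables, the second of which may be replaced by
a copy `Z'`. -/
lemma integral_prodMk_of_indep {μ : Measure Ω} [IsFiniteMeasure μ] {Z' : Ω → γ}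
    (hX : FiniteValued X) (hZ : FiniteValued Z) (hZ' : FiniteValued Z') {T : Finset γ}
    (hT : ∀ ω, Z ω ∈ T) (hT' : ∀ ω, Z' ω ∈ T)
    (hind : ∀ x t, μ.real (X ⁻¹' {x} ∩ Z ⁻¹' {t}) = μ.real (X ⁻¹' {x}) * μ.real (Z' ⁻¹' {t}))
    (Φ : β → γ → ℝ) :
    ∫ ω, Φ (X ω) (Z ω) ∂μ = ∫ ω, ∫ ω', Φ (X ω) (Z' ω') ∂μ ∂μ := by
  have hR : ∀ ω, X ω ∈ hX.1.toFinset := fun ω => by simp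
  have h1 := (hX.prodMk hZ).integral_eq_sum (μ := μ) (T := hX.1.toFinset ×ˢ T)
    (fun ω => Finset.mk_mem_product (hR ω) (hT ω)) (fun p => Φ p.1 p.2)
  simp only at h1
  rw [h1, hX.integral_eq_sum hR (fun x => ∫ ω', Φ x (Z' ω') ∂μ), Finset.sum_product]
  refine Finset.sum_congr rfl fun x _ => ?_
  rw [hZ'.integral_eq_sum hT', Finset.mul_sum]
  refine Finset.sum_congr rfl fun t _ => ?_
  rw [← mul_assoc, ← hind]
  congr 2
  ext ω
  simp [Prod.ext_iff]

end FiniteValued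

/-! ### Trajectories of the sorted age vector -/

section Trajectories

variable {m : ℕ} {𝒵 : Finset ℝ}

lemma hist_congr {y y' : ℕ → ℝ} {i : ℕ} (h : ∀ j < i, y j = y' j) : hist y i = hist y' i :=
  funext fun j => h j j.2

lemma stateAt_congr (f : Sampler 𝒵) (s : State m) {y y' : ℕ → ℝ} :
    ∀ {i : ℕ}, (∀ j < i, y j = y' j) → stateAt f s y i = stateAt f s y' i
  | 0, _ => rfl
  | i + 1, h => by
    simp only [stateAt]
    rw [stateAt_congr f s fun j hj => h j (hj.trans i.lt_succ_self), h i i.lt_succ_self,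
      hist_congr fun j hj => h j (hj.trans i.lt_succ_self)]

/-- A sequence of service times that starts with `v`. -/
def extend {i : ℕ} (v : Fin i → ℝ) : ℕ → ℝ := fun j => if h : j < i then v ⟨j, h⟩ else 0

lemma extend_hist (y : ℕ → ℝ) {i j : ℕ} (h : j < i) : extend (hist y i) j = y j := by
  simp [extend, hist, h]

lemma stateAt_extend_hist (f : Sampler 𝒵) (s : State m) (y : ℕ → ℝ) (i : ℕ) :
    stateAt f s (extend (hist y i)) i = stateAt f s y i :=
  stateAt_congr f s fun _ hj => extend_hist y hj

lemma closedLoopState_hist (q : State m → 𝒵) (s : State m) (y : ℕ → ℝ) :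
    ∀ i, closedLoopState q s i (hist y i) = stateAt (stationarySampler q s) s y i
  | 0 => rfl
  | i + 1 => by
    have ih := closedLoopState_hist q s y i
    have h : (fun j : Fin i => hist y (i + 1) j.castSucc) = hist y i := rfl
    simp only [closedLoopState, stateAt, stationarySampler, h, ih]
    rfl

lemma stationarySampler_hist (q : State m → 𝒵) (s : State m) (y : ℕ → ℝ) (i : ℕ) :
    stationarySampler q s i (hist y i) = q (stateAt (stationarySampler q s) s y i) := by
  rw [← closedLoopState_hist]
  rfl

/-- The same sampler brings any two initial states together: entry `l` forgets the initial state
after `m - l` stages. -/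
lemma stateAt_apply_eq (f : Sampler 𝒵) (s s' : State m) (y : ℕ → ℝ) :
    ∀ (i : ℕ) (l : Fin m), m ≤ l + i → stateAt f s y i l = stateAt f s' y i l
  | 0, l, h => absurd l.2 (by omega)
  | i + 1, l, h => by
    simp only [stateAt, next]
    split_ifs with hl
    · rw [stateAt_apply_eq f s s' y i ⟨l + 1, hl⟩ (by simp only; omega)]
    · rfl

lemma stateAt_eq_of_le (f : Sampler 𝒵) (s s' : State m) (y : ℕ → ℝ) {i : ℕ} (h : m ≤ i) :
    stateAt f s y i = stateAt f s' y i :=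
  funext fun l => stateAt_apply_eq f s s' y i l (by omega)

lemma next_mono {s s' : State m} (hs : s ≤ s') {z z' : ℝ} (hz : z ≤ z') (y : ℝ) :
    next s z y ≤ next s' z' y := by
  intro l
  simp only [next]
  split_ifs with hl
  · linarith [hs ⟨l + 1, hl⟩]
  · rfl

lemma stateAt_mono (f : Sampler 𝒵) {s s' : State m} (hs : s ≤ s') (y : ℕ → ℝ) :
    ∀ i, stateAt f s y i ≤ stateAt f s' y i
  | 0 => hs
  | i + 1 => next_mono (stateAt_mono f hs y i) le_rfl _

end Trajectories

namespace System

variable {Ω : Type*} [MeasurableSpace Ω] {m : ℕ} (M : System Ω m)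

instance : IsProbabilityMeasure M.μ := M.isProb

/-! ### Service times, state space and stage costs -/

lemma finiteValued_Y (i : ℕ) : FiniteValued (M.Y i) :=
  ⟨M.serviceTimes.finite_toSet.subset (Set.range_subset_iff.2 (M.Y_mem i)),
    fun t => M.Y_meas i (measurableSet_singleton t)⟩

lemma finiteValued_hist (i : ℕ) : FiniteValued fun ω => hist (M.path ω) i := by
  classical
  refine ⟨(Fintype.piFinset fun _ : Fin i => M.serviceTimes).finite_toSet.subset ?_, fun t => ?_⟩
  · rintro _ ⟨ω, rfl⟩
    simpa [hist, path] using fun j : Fin i => M.Y_mem j ω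
  · have : Measurable fun ω => hist (M.path ω) i := measurable_pi_lambda _ fun j => M.Y_meas j
    exact this (measurableSet_singleton t)

lemma indepFun_hist (i : ℕ) : IndepFun (fun ω => hist (M.path ω) i) (M.Y i) M.μ := by
  have h := M.Y_indep.indepFun_finset (Finset.range i) {i} (by simp) M.Y_meas
  have h1 : Measurable fun (v : Finset.range i → ℝ) (j : Fin i) => v ⟨j, by simp⟩ := by fun_prop
  have h2 : Measurable fun v : ({i} : Finset ℕ) → ℝ => v ⟨i, by simp⟩ := by fun_prop
  exact h.comp h1 h2

/-- The service time of a stage may be averaged separately from the past. -/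
lemma integral_hist_Y {i : ℕ} (Φ : (Fin i → ℝ) → ℝ → ℝ) :
    ∫ ω, Φ (hist (M.path ω) i) (M.Y i ω) ∂M.μ =
      ∫ ω, ∫ ω', Φ (hist (M.path ω) i) (M.Y 0 ω') ∂M.μ ∂M.μ := by
  refine (M.finiteValued_hist i).integral_prodMk_of_indep (M.finiteValued_Y i) (M.finiteValued_Y 0)
    (M.Y_mem i) (M.Y_mem 0) (fun x t => ?_) Φ
  simp only [Measure.real]
  rw [(M.indepFun_hist i).measure_inter_preimage_eq_mul _ _ (measurableSet_singleton x)
    (measurableSet_singleton t), ENNReal.toReal_mul,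
    (M.Y_ident i).measure_mem_eq (measurableSet_singleton t)]

lemma IsState.nonneg {M : System Ω m} {s : State m} (hs : M.IsState s) : 0 ≤ s := by
  induction hs with
  | init => exact fun l => M.initAge_nonneg _
  | step hs hz hy ih =>
    intro l
    simp only [next]
    split_ifs with hl
    · have := ih ⟨l + 1, hl⟩
      have := M.waiting_nonneg _ hz
      have := M.service_nonneg _ hy
      simp only [Pi.zero_apply] at *
      linarith
    · exact M.service_nonneg _ hy

lemma isState_stateAt {s : State m} (hs : M.IsState s) (f : Sampler M.waitingTimes) (ω : Ω) :
    ∀ i, M.IsState (stateAt f s (M.path ω) i)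
  | 0 => hs
  | i + 1 => (isState_stateAt hs f ω i).step (f i _).2 (M.Y_mem i ω)

/-- Entry `l` of a state depends only on the initial entries and on the last `m - l` waiting and
service times, so there are finitely many states. -/
lemma finite_setOf_isState : {s | M.IsState s}.Finite := by
  have key : ∀ (k : ℕ) (l : Fin m), l + k + 1 = m →
      ((fun s : State m => s l) '' {s | M.IsState s}).Finite := by
    intro k
    induction k with
    | zero =>
      intro l hl
      refine ((Set.finite_singleton (M.initState l)).union M.serviceTimes.finite_toSet).subset ?_
      rintro _ ⟨s, hs, rfl⟩
      rcases hs with _ | ⟨hs, hz, hy⟩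
      · exact Or.inl rfl
      · right
        simpa [next, show ¬ (l : ℕ) + 1 < m by omega] using hy
    | succ k ih =>
      intro l hl
      have hl' : (l : ℕ) + 1 < m := by omega
      have h := ih ⟨l + 1, hl'⟩ (by simp only; omega)
      refine ((Set.finite_singleton (M.initState l)).union
        ((h.add M.waitingTimes.finite_toSet).add M.serviceTimes.finite_toSet)).subset ?_
      rintro _ ⟨s, hs, rfl⟩
      rcases hs with _ | ⟨hs, hz, hy⟩
      · exact Or.inl rfl
      · right
        simp only [next, hl', dite_true]
        exact Set.add_mem_add (Set.add_mem_add ⟨_, hs, rfl⟩ hz) hy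
  refine (Set.Finite.pi fun l : Fin m => key (m - l - 1) l (by have := l.2; omega)).subset ?_
  exact fun s hs l _ => ⟨s, hs, rfl⟩

instance : Finite {s // M.IsState s} := M.finite_setOf_isState.to_subtype

lemma exists_bound_on_states (F : State m → ℝ) : ∃ B, 0 ≤ B ∧ ∀ s, M.IsState s → |F s| ≤ B := by
  obtain ⟨B, hB⟩ := (M.finite_setOf_isState.image F).isBounded.exists_norm_le
  exact ⟨max B 0, le_max_right _ _, fun s hs => (hB _ ⟨s, hs, rfl⟩).trans (le_max_left _ _)⟩

lemma exists_cost_bound :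
    ∃ B, 0 ≤ B ∧ ∀ s, M.IsState s → ∀ z ∈ M.waitingTimes, |M.cost s z| ≤ B := by
  obtain ⟨B, hB⟩ := ((M.finite_setOf_isState.prod M.waitingTimes.finite_toSet).image
    fun p => M.cost p.1 p.2).isBounded.exists_norm_le
  exact ⟨max B 0, le_max_right _ _, fun s hs z hz =>
    (hB _ ⟨(s, z), ⟨hs, hz⟩, rfl⟩).trans (le_max_left _ _)⟩

lemma intervalIntegrable_g {a b : ℝ} (ha : 0 ≤ a) (hb : 0 ≤ b) :
    IntervalIntegrable M.g volume a b :=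
  (M.g_mono.mono fun _ hx => le_trans (le_min ha hb) hx.1).intervalIntegrable

lemma integral_g_mono {a b w : ℝ} (ha : 0 ≤ a) (hab : a ≤ b) (hw : 0 ≤ w) :
    ∫ τ in a..a + w, M.g τ ≤ ∫ τ in b..b + w, M.g τ := by
  have hmono : ∀ c : ℝ, 0 ≤ c → MonotoneOn (fun τ => M.g (c + τ)) (Set.uIcc 0 w) := by
    intro c hc x hx x' hx' hxx'
    rw [Set.uIcc_of_le hw] at hx hx'
    exact M.g_mono (add_nonneg hc hx.1) (add_nonneg hc hx'.1) (by linarith)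
  have h : ∀ c : ℝ, ∫ τ in c..c + w, M.g τ = ∫ τ in (0 : ℝ)..w, M.g (c + τ) := by
    intro c
    rw [intervalIntegral.integral_comp_add_left, add_zero]
  rw [h, h]
  refine intervalIntegral.integral_mono_on hw (hmono a ha).intervalIntegrable
    (hmono b (ha.trans hab)).intervalIntegrable fun x hx => ?_
  exact M.g_mono (add_nonneg ha hx.1) (add_nonneg (ha.trans hab) hx.1) (by linarith)

lemma integrable_comp_Y (F : ℝ → ℝ) : Integrable (fun ω => F (M.Y 0 ω)) M.μ :=
  ((M.finiteValued_Y 0).comp F).integrable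

lemma cost_mono {s s' : State m} (hs : 0 ≤ s) (hss' : s ≤ s') {z : ℝ} (hz : 0 ≤ z) :
    M.cost s z ≤ M.cost s' z := by
  refine integral_mono (M.integrable_comp_Y fun y =>
    (∑ l, ∫ τ in (s l)..(s l + z + y), M.g τ) - M.optTaAP * (z + y))
    (M.integrable_comp_Y fun y =>
      (∑ l, ∫ τ in (s' l)..(s' l + z + y), M.g τ) - M.optTaAP * (z + y)) fun ω => ?_
  refine sub_le_sub_right (Finset.sum_le_sum fun l _ => ?_) _
  rw [add_assoc, add_assoc]
  exact M.integral_g_mono (hs l) (hss' l) (add_nonneg hz (M.service_nonneg _ (M.Y_mem 0 ω)))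

/-- Waiting for `z` costs at least `z * (∑ l, 𝔼 g (s l + Y) - optTaAP)` more than not waiting,
because `g` is monotone. -/
lemma cost_zero_le {s : State m} (hs : 0 ≤ s) (hp : M.PassesThreshold s) {z : ℝ} (hz : 0 ≤ z) :
    M.cost s 0 ≤ M.cost s z := by
  have key : ∀ ω, ((∑ l, ∫ τ in (s l)..(s l + 0 + M.Y 0 ω), M.g τ) - M.optTaAP * (0 + M.Y 0 ω))
      + (z * (∑ l, M.g (s l + M.Y 0 ω)) - z * M.optTaAP)
      ≤ (∑ l, ∫ τ in (s l)..(s l + z + M.Y 0 ω), M.g τ) - M.optTaAP * (z + M.Y 0 ω) := by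
    intro ω
    have hy := M.service_nonneg _ (M.Y_mem 0 ω)
    have : ∀ l, (∫ τ in (s l)..(s l + 0 + M.Y 0 ω), M.g τ) + z * M.g (s l + M.Y 0 ω)
        ≤ ∫ τ in (s l)..(s l + z + M.Y 0 ω), M.g τ := by
      intro l
      have hl : 0 ≤ s l := hs l
      have ha : 0 ≤ s l + M.Y 0 ω := add_nonneg hl hy
      have hb : 0 ≤ s l + z + M.Y 0 ω := by positivity
      rw [add_zero, ← intervalIntegral.integral_add_adjacent_intervals
        (M.intervalIntegrable_g hl ha) (M.intervalIntegrable_g ha hb)]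
      have h1 : ∫ _ in (s l + M.Y 0 ω)..(s l + z + M.Y 0 ω), M.g (s l + M.Y 0 ω)
          = z * M.g (s l + M.Y 0 ω) := by
        rw [intervalIntegral.integral_const, smul_eq_mul]
        ring
      rw [← h1]
      refine add_le_add_right (intervalIntegral.integral_mono_on (by linarith)
        intervalIntegrable_const (M.intervalIntegrable_g ha hb) fun x hx => ?_) _
      exact M.g_mono ha (ha.trans hx.1) hx.1
    have := Finset.sum_le_sum fun l (_ : l ∈ Finset.univ) => this l
    rw [Finset.sum_add_distrib, ← Finset.mul_sum] at this
    linarith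
  have hG := M.integrable_comp_Y fun y => ∑ l, M.g (s l + y)
  have h0 := M.integrable_comp_Y fun y =>
    (∑ l, ∫ τ in (s l)..(s l + 0 + y), M.g τ) - M.optTaAP * (0 + y)
  have hZ := M.integrable_comp_Y fun y =>
    (∑ l, ∫ τ in (s l)..(s l + z + y), M.g τ) - M.optTaAP * (z + y)
  have hD : Integrable (fun ω => z * (∑ l, M.g (s l + M.Y 0 ω)) - z * M.optTaAP) M.μ :=
    (hG.const_mul z).sub (integrable_const _)
  have h := integral_mono (h0.add hD) hZ key
  simp only [Pi.add_apply] at h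
  rw [integral_add h0 hD, integral_sub (hG.const_mul z) (integrable_const _), integral_const_mul, integral_const] at h
  simp only [probReal_univ, one_smul] at h
  have := mul_le_mul_of_nonneg_left hp hz
  unfold cost
  linarith

/-! ### Expected costs along a trajectory -/

lemma finiteValued_stage (f : Sampler M.waitingTimes) (s : State m) (i : ℕ) :
    FiniteValued fun ω => (stateAt f s (M.path ω) i, f i (hist (M.path ω) i)) := by
  simp_rw [← stateAt_extend_hist f s (M.path _) i]
  exact (M.finiteValued_hist i).comp fun v => (stateAt f s (extend v) i, f i v)

lemma integrable_stage (f : Sampler M.waitingTimes) (s : State m) (i : ℕ)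
    (F : State m → M.waitingTimes → ℝ) :
    Integrable (fun ω => F (stateAt f s (M.path ω) i) (f i (hist (M.path ω) i))) M.μ :=
  ((M.finiteValued_stage f s i).comp fun p => F p.1 p.2).integrable

lemma integrable_sum_cost (α : ℝ) (f : Sampler M.waitingTimes) (s : State m) (n : ℕ) :
    Integrable (fun ω => ∑ i ∈ Finset.range n,
      α ^ i * M.cost (stateAt f s (M.path ω) i) (f i (hist (M.path ω) i))) M.μ :=
  integrable_finsetSum _ fun i _ => M.integrable_stage f s i fun s z => α ^ i * M.cost s z

/-- The right-hand side of the `α`-discounted Bellman equation before minimization. -/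
noncomputable def discountedBellman (α : ℝ) (W : State m → ℝ) (s : State m) (z : ℝ) : ℝ :=
  M.cost s z + α * ∫ ω, W (next s z (M.Y 0 ω)) ∂M.μ

lemma discountedBellman_one (W : State m → ℝ) : M.discountedBellman 1 W = M.bellman W := by
  funext s z
  simp [discountedBellman, bellman]

lemma discountedBellman_congr (α : ℝ) {W W' : State m → ℝ} (h : ∀ s, M.IsState s → W s = W' s)
    {s : State m} (hs : M.IsState s) {z : ℝ} (hz : z ∈ M.waitingTimes) :
    M.discountedBellman α W s z = M.discountedBellman α W' s z := by
  simp only [discountedBellman, fun ω => h _ (hs.step hz (M.Y_mem 0 ω))]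

/-- The expectation of `W` at the state reached after `n` stages. -/
noncomputable def expectedValue (W : State m → ℝ) (s : State m) (f : Sampler M.waitingTimes)
    (n : ℕ) : ℝ :=
  ∫ ω, W (stateAt f s (M.path ω) n) ∂M.μ

lemma abs_expectedValue_le {W : State m → ℝ} {B : ℝ} (hB : ∀ s, M.IsState s → |W s| ≤ B)
    {s : State m} (hs : M.IsState s) (f : Sampler M.waitingTimes) (n : ℕ) :
    |M.expectedValue W s f n| ≤ B := by
  have h : ∀ ω, ‖W (stateAt f s (M.path ω) n)‖ ≤ B := fun ω =>
    hB _ (M.isState_stateAt hs f ω n)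
  have := norm_integral_le_of_norm_le_const (μ := M.μ) (Eventually.of_forall h)
  simpa [expectedValue] using this

/-- Paying for one more stage and then collecting `W` is the same as collecting the right-hand
side of Bellman's equation for `W`. -/
lemma discountedCost_succ_add (α : ℝ) (W : State m → ℝ) (s : State m)
    (f : Sampler M.waitingTimes) (n : ℕ) :
    M.discountedCost α s f (n + 1) + α ^ (n + 1) * M.expectedValue W s f (n + 1) =
      M.discountedCost α s f n + α ^ n * ∫ ω, M.discountedBellman α W
        (stateAt f s (M.path ω) n) (f n (hist (M.path ω) n)) ∂M.μ := by
  have h1 : M.discountedCost α s f (n + 1) = M.discountedCost α s f n + α ^ n *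
      ∫ ω, M.cost (stateAt f s (M.path ω) n) (f n (hist (M.path ω) n)) ∂M.μ := by
    simp only [discountedCost, Finset.sum_range_succ]
    rw [integral_add (M.integrable_sum_cost α f s n)
      (M.integrable_stage f s n fun s z => α ^ n * M.cost s z), integral_const_mul]
  have h2 : M.expectedValue W s f (n + 1) = ∫ ω, ∫ ω', W (next (stateAt f s (M.path ω) n)
      (f n (hist (M.path ω) n)) (M.Y 0 ω')) ∂M.μ ∂M.μ := by
    have := M.integral_hist_Y (i := n) fun v y => W (next (stateAt f s (extend v) n) (f n v) y)
    simp only [stateAt_extend_hist] at this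
    exact this
  have h3 : ∫ ω, M.discountedBellman α W (stateAt f s (M.path ω) n) (f n (hist (M.path ω) n)) ∂M.μ
      = (∫ ω, M.cost (stateAt f s (M.path ω) n) (f n (hist (M.path ω) n)) ∂M.μ) +
        α * M.expectedValue W s f (n + 1) := by
    rw [h2, ← integral_const_mul]
    exact integral_add (M.integrable_stage f s n fun s z => M.cost s z)
      (M.integrable_stage f s n fun s z => α * ∫ ω', W (next s z (M.Y 0 ω')) ∂M.μ)
  rw [h1, h3]
  ring

/-- The verification inequality. It serves the discounted problem with `lam = 0` and the average
cost problem with `α = 1`. -/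
lemma le_discountedCost_add {α : ℝ} (hα : 0 ≤ α) {lam : ℝ} {W : State m → ℝ}
    (hW : ∀ s, M.IsState s → ∀ z ∈ M.waitingTimes, lam + W s ≤ M.discountedBellman α W s z)
    {s : State m} (hs : M.IsState s) (f : Sampler M.waitingTimes) (n : ℕ) :
    (∑ i ∈ Finset.range n, α ^ i) * lam + W s ≤
      M.discountedCost α s f n + α ^ n * M.expectedValue W s f n := by
  induction n with
  | zero => simp [discountedCost, expectedValue, stateAt]
  | succ n ih =>
    have h := integral_mono (M.integrable_stage f s n fun s _ => lam + W s)
      (M.integrable_stage f s n fun s z => M.discountedBellman α W s z)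
      (fun ω => hW _ (M.isState_stateAt hs f ω n) _ (f n _).2)
    rw [integral_add (integrable_const _) (M.integrable_stage f s n fun s _ => W s)] at h
    simp only [integral_const, probReal_univ, one_smul] at h
    rw [discountedCost_succ_add, Finset.sum_range_succ]
    have := mul_le_mul_of_nonneg_left h (pow_nonneg hα n)
    unfold expectedValue at ih
    linarith

lemma discountedCost_stationary_add {α : ℝ} {lam : ℝ} {W : State m → ℝ}
    {q : State m → M.waitingTimes}
    (hW : ∀ s, M.IsState s → lam + W s = M.discountedBellman α W s (q s))
    {s : State m} (hs : M.IsState s) (n : ℕ) :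
    M.discountedCost α s (stationarySampler q s) n +
        α ^ n * M.expectedValue W s (stationarySampler q s) n =
      (∑ i ∈ Finset.range n, α ^ i) * lam + W s := by
  induction n with
  | zero => simp [discountedCost, expectedValue, stateAt]
  | succ n ih =>
    rw [discountedCost_succ_add]
    simp_rw [stationarySampler_hist, ← hW _ (M.isState_stateAt hs _ _ n)]
    rw [integral_add (integrable_const _)
      (M.integrable_stage (stationarySampler q s) s n fun s _ => W s), Finset.sum_range_succ]
    simp only [integral_const, probReal_univ, one_smul]
    unfold expectedValue at ih
    linarith

lemma abs_discountedCost_le {α : ℝ} (hα : 0 ≤ α) {B : ℝ}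
    (hB : ∀ s, M.IsState s → ∀ z ∈ M.waitingTimes, |M.cost s z| ≤ B)
    {s : State m} (hs : M.IsState s) (f : Sampler M.waitingTimes) (n : ℕ) :
    |M.discountedCost α s f n| ≤ ∑ i ∈ Finset.range n, α ^ i * B := by
  have h : ∀ ω, ‖∑ i ∈ Finset.range n,
      α ^ i * M.cost (stateAt f s (M.path ω) i) (f i (hist (M.path ω) i))‖ ≤
      ∑ i ∈ Finset.range n, α ^ i * B := fun ω => norm_sum_le_of_le _ fun i _ => by
    rw [norm_mul, Real.norm_of_nonneg (pow_nonneg hα i)]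
    exact mul_le_mul_of_nonneg_left (hB _ (M.isState_stateAt hs f ω i) _ (f i _).2)
      (pow_nonneg hα i)
  have := norm_integral_le_of_norm_le_const (μ := M.μ) (Eventually.of_forall h)
  simpa [discountedCost] using this

lemma discountedCost_mono {α : ℝ} (hα : 0 ≤ α) {s s' : State m} (hs : M.IsState s)
    (hss' : s ≤ s') (f : Sampler M.waitingTimes) (n : ℕ) :
    M.discountedCost α s f n ≤ M.discountedCost α s' f n := by
  refine integral_mono (M.integrable_sum_cost α f s n) (M.integrable_sum_cost α f s' n) fun ω => ?_
  refine Finset.sum_le_sum fun i _ => mul_le_mul_of_nonneg_left ?_ (pow_nonneg hα i)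
  exact M.cost_mono (M.isState_stateAt hs f ω i).nonneg (stateAt_mono f hss' _ i)
    (M.waiting_nonneg _ (f i _).2)

/-- Under the same sampler the costs from two initial states differ in the first `m` stages only. -/
lemma discountedCost_le_add {α : ℝ} (hα : 0 ≤ α) (hα1 : α ≤ 1) {B : ℝ}
    (hB : ∀ s, M.IsState s → ∀ z ∈ M.waitingTimes, |M.cost s z| ≤ B)
    {s s' : State m} (hs : M.IsState s) (hs' : M.IsState s') (f : Sampler M.waitingTimes) (n : ℕ) :
    M.discountedCost α s f n ≤ M.discountedCost α s' f n + m * (2 * B) := by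
  have hB0 : 0 ≤ B := (abs_nonneg _).trans (hB s hs 0 M.zero_mem)
  have h : ∀ ω, ∑ i ∈ Finset.range n,
        α ^ i * M.cost (stateAt f s (M.path ω) i) (f i (hist (M.path ω) i)) ≤
      ∑ i ∈ Finset.range n,
        α ^ i * M.cost (stateAt f s' (M.path ω) i) (f i (hist (M.path ω) i)) + m * (2 * B) := by
    intro ω
    have h1 : ∀ i ∈ Finset.range n,
        α ^ i * M.cost (stateAt f s (M.path ω) i) (f i (hist (M.path ω) i)) ≤
        α ^ i * M.cost (stateAt f s' (M.path ω) i) (f i (hist (M.path ω) i)) +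
          if i < m then 2 * B else 0 := by
      intro i _
      split_ifs with him
      · have h2 := (abs_le.1 (hB _ (M.isState_stateAt hs f ω i) _ (f i (hist (M.path ω) i)).2)).2
        have h3 := (abs_le.1 (hB _ (M.isState_stateAt hs' f ω i) _ (f i (hist (M.path ω) i)).2)).1
        have h4 := pow_nonneg hα i
        have h5 := pow_le_one₀ (n := i) hα hα1
        have h6 := mul_le_mul_of_nonneg_left h2 h4
        have h7 := mul_le_mul_of_nonneg_left h3 h4
        have h8 := mul_le_mul_of_nonneg_right h5 hB0
        linarith
      · rw [stateAt_eq_of_le f s s' _ (not_lt.1 him), add_zero]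
    refine (Finset.sum_le_sum h1).trans ?_
    rw [Finset.sum_add_distrib, ← Finset.sum_filter, Finset.sum_const, nsmul_eq_mul]
    have hc : ((Finset.range n).filter (· < m)).card ≤ m := by
      refine (Finset.card_le_card (t := Finset.range m) fun i hi => ?_).trans_eq
        (Finset.card_range m)
      exact Finset.mem_range.2 (Finset.mem_filter.1 hi).2
    gcongr
  have := integral_mono (M.integrable_sum_cost α f s n)
    ((M.integrable_sum_cost α f s' n).add (integrable_const (m * (2 * B)))) h
  simp only [Pi.add_apply] at this
  rw [integral_add (M.integrable_sum_cost α f s' n) (integrable_const _)] at this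
  simpa [discountedCost] using this

/-! ### The discounted problem -/

lemma tendsto_pow_mul_expectedValue {α : ℝ} (hα : 0 ≤ α) (hα1 : α < 1) (W : State m → ℝ)
    {s : State m} (hs : M.IsState s) (f : Sampler M.waitingTimes) :
    Tendsto (fun n => α ^ n * M.expectedValue W s f n) atTop (𝓝 0) := by
  obtain ⟨B, _, hB⟩ := M.exists_bound_on_states W
  exact (tendsto_pow_atTop_nhds_zero_of_lt_one hα hα1).zero_mul_isBoundedUnder_le
    (isBoundedUnder_of ⟨B, fun n => M.abs_expectedValue_le hB hs f n⟩)

lemma tendsto_discountedCost_stationary {α : ℝ} (hα : 0 ≤ α) (hα1 : α < 1) {W : State m → ℝ}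
    {q : State m → M.waitingTimes}
    (hW : ∀ s, M.IsState s → W s = M.discountedBellman α W s (q s))
    {s : State m} (hs : M.IsState s) :
    Tendsto (M.discountedCost α s (stationarySampler q s)) atTop (𝓝 (W s)) := by
  have h := (M.tendsto_pow_mul_expectedValue hα hα1 W hs (stationarySampler q s)).const_sub (W s)
  rw [sub_zero] at h
  refine h.congr fun n => ?_
  have := M.discountedCost_stationary_add (lam := 0)
    (fun s hs => (zero_add _).trans (hW s hs)) hs n
  linarith

lemma le_limsup_discountedCost {α : ℝ} (hα : 0 ≤ α) (hα1 : α < 1) {W : State m → ℝ}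
    (hW : ∀ s, M.IsState s → ∀ z ∈ M.waitingTimes, W s ≤ M.discountedBellman α W s z)
    {s : State m} (hs : M.IsState s) (f : Sampler M.waitingTimes) :
    W s ≤ limsup (fun n => M.discountedCost α s f n) atTop := by
  have h := (M.tendsto_pow_mul_expectedValue hα hα1 W hs f).const_sub (W s)
  rw [sub_zero] at h
  rw [← h.limsup_eq]
  obtain ⟨B, hB0, hB⟩ := M.exists_cost_bound
  refine limsup_le_limsup (Eventually.of_forall fun n => ?_) h.isCoboundedUnder_le ?_
  · have := M.le_discountedCost_add hα (lam := 0)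
      (fun s hs z hz => (zero_add (W s)).le.trans (hW s hs z hz)) hs f n
    simp only
    linarith
  · refine isBoundedUnder_of ⟨(1 - α)⁻¹ * B, fun n => ?_⟩
    refine (le_abs_self _).trans ((M.abs_discountedCost_le hα hB hs f n).trans ?_)
    rw [← Finset.sum_mul, ← tsum_geometric_of_lt_one hα hα1]
    exact mul_le_mul_of_nonneg_right ((summable_geometric_of_lt_one hα hα1).sum_le_tsum _
      fun i _ => pow_nonneg hα i) hB0

/-- The discounted Bellman operator is an `α`-contraction for the supremum norm, so it has a fixed
point, given here with a decision rule that attains the minima. -/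
lemma exists_discounted_fixedPoint {α : ℝ} (hα : 0 ≤ α) (hα1 : α < 1) :
    ∃ (W : State m → ℝ) (q : State m → M.waitingTimes),
      (∀ s, M.IsState s → ∀ z ∈ M.waitingTimes, W s ≤ M.discountedBellman α W s z) ∧
      ∀ s, M.IsState s → W s = M.discountedBellman α W s (q s) := by
  classical
  have : Fintype {s // M.IsState s} := Fintype.ofFinite _
  have hne : M.waitingTimes.Nonempty := ⟨0, M.zero_mem⟩
  let E : ({s // M.IsState s} → ℝ) → State m → ℝ :=
    fun w s => if h : M.IsState s then w ⟨s, h⟩ else 0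
  have hE : ∀ w w' s, E w s ≤ E w' s + dist w w' := by
    intro w w' s
    simp only [E]
    split_ifs with h
    · have := (abs_le.1 (Real.dist_eq _ _ ▸ dist_le_pi_dist w w' ⟨s, h⟩)).2
      linarith
    · simp
  let T : ({s // M.IsState s} → ℝ) → ({s // M.IsState s} → ℝ) :=
    fun w s => M.waitingTimes.inf' hne (M.discountedBellman α (E w) s)
  have hT : ∀ w w' s, T w s ≤ T w' s + α * dist w w' := by
    intro w w' s
    obtain ⟨z, hz, hzeq⟩ :=
      Finset.exists_mem_eq_inf' hne (M.discountedBellman α (E w') s)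
    have h1 : T w s ≤ M.discountedBellman α (E w) s z := Finset.inf'_le _ hz
    have h2 : T w' s = M.discountedBellman α (E w') s z := hzeq
    have h3 := integral_mono (M.integrable_comp_Y fun y => E w (next s z y))
      ((M.integrable_comp_Y fun y => E w' (next s z y)).add (integrable_const (dist w w')))
      (fun ω => hE w w' _)
    simp only [Pi.add_apply] at h3
    rw [integral_add (M.integrable_comp_Y fun y => E w' (next s z y)) (integrable_const _)] at h3
    simp only [integral_const, probReal_univ, one_smul] at h3
    have h4 := mul_le_mul_of_nonneg_left h3 hα
    simp only [discountedBellman] at h1 h2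
    linarith
  have hc : ContractingWith ⟨α, hα⟩ T := by
    refine ⟨by exact_mod_cast hα1, LipschitzWith.of_dist_le_mul fun w w' => ?_⟩
    refine (dist_pi_le_iff (by positivity)).2 fun s => ?_
    rw [Real.dist_eq, abs_le]
    have h1 := hT w w' s
    have h2 := hT w' w s
    rw [dist_comm w' w] at h2
    change -(α * _) ≤ _ ∧ _ ≤ α * _
    constructor <;> linarith
  set w := ContractingWith.fixedPoint T hc
  have hw : ∀ s : {s // M.IsState s}, E w s =
      M.waitingTimes.inf' hne (M.discountedBellman α (E w) s) := by
    intro s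
    simp only [E, s.2, dite_true]
    exact (congrFun hc.fixedPoint_isFixedPt s).symm
  have hq : ∀ s, ∃ z : M.waitingTimes, M.waitingTimes.inf' hne (M.discountedBellman α (E w) s) =
      M.discountedBellman α (E w) s z := by
    intro s
    obtain ⟨z, hz, h⟩ := Finset.exists_mem_eq_inf' hne (M.discountedBellman α (E w) s)
    exact ⟨⟨z, hz⟩, h⟩
  choose q hq using hq
  exact ⟨E w, q, fun s hs z hz => (hw ⟨s, hs⟩).trans_le (Finset.inf'_le _ hz),
    fun s hs => (hw ⟨s, hs⟩).trans (hq s)⟩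

lemma optDiscounted_eq {α : ℝ} (hα : 0 ≤ α) (hα1 : α < 1) {W : State m → ℝ}
    {q : State m → M.waitingTimes}
    (hW : ∀ s, M.IsState s → ∀ z ∈ M.waitingTimes, W s ≤ M.discountedBellman α W s z)
    (hq : ∀ s, M.IsState s → W s = M.discountedBellman α W s (q s))
    {s : State m} (hs : M.IsState s) : M.optDiscounted α s = W s := by
  have h := fun f => M.le_limsup_discountedCost hα hα1 hW hs f
  have : Nonempty (Sampler M.waitingTimes) := ⟨stationarySampler q s⟩
  refine le_antisymm ?_ (le_ciInf h)
  refine (ciInf_le ⟨W s, ?_⟩ (stationarySampler q s)).trans_eq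
    (M.tendsto_discountedCost_stationary hα hα1 hq hs).limsup_eq
  rintro _ ⟨f, rfl⟩
  exact h f

/-- `optDiscounted α` solves the discounted Bellman equation. -/
lemma optDiscounted_bellman {α : ℝ} (hα : 0 ≤ α) (hα1 : α < 1) :
    (∀ s, M.IsState s → ∀ z ∈ M.waitingTimes,
      M.optDiscounted α s ≤ M.discountedBellman α (M.optDiscounted α) s z) ∧
    ∃ q : State m → M.waitingTimes, ∀ s, M.IsState s →
      M.optDiscounted α s = M.discountedBellman α (M.optDiscounted α) s (q s) := by
  obtain ⟨W, q, hW, hq⟩ := M.exists_discounted_fixedPoint hα hα1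
  have h : ∀ s, M.IsState s → M.optDiscounted α s = W s :=
    fun s hs => M.optDiscounted_eq hα hα1 hW hq hs
  refine ⟨fun s hs z hz => ?_, q, fun s hs => ?_⟩
  · rw [h s hs, M.discountedBellman_congr α h hs hz]
    exact hW s hs z hz
  · rw [h s hs, M.discountedBellman_congr α h hs (q s).2]
    exact hq s hs

lemma exists_tendsto_optDiscounted {α : ℝ} (hα : 0 ≤ α) (hα1 : α < 1) {s : State m}
    (hs : M.IsState s) :
    ∃ f, Tendsto (M.discountedCost α s f) atTop (𝓝 (M.optDiscounted α s)) := by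
  obtain ⟨q, hq⟩ := (M.optDiscounted_bellman hα hα1).2
  exact ⟨_, M.tendsto_discountedCost_stationary hα hα1 hq hs⟩

lemma optDiscounted_le_of_tendsto {α : ℝ} (hα : 0 ≤ α) (hα1 : α < 1) {s : State m}
    (hs : M.IsState s) {f : Sampler M.waitingTimes} {u : ℕ → ℝ} {c : ℝ}
    (hu : Tendsto u atTop (𝓝 c)) (h : ∀ n, M.discountedCost α s f n ≤ u n) :
    M.optDiscounted α s ≤ c := by
  have h1 := hu.add (M.tendsto_pow_mul_expectedValue hα hα1 (M.optDiscounted α) hs f)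
  rw [add_zero] at h1
  refine ge_of_tendsto' h1 fun n => ?_
  have := M.le_discountedCost_add hα (lam := 0) (fun s hs z hz =>
    (zero_add (M.optDiscounted α s)).le.trans ((M.optDiscounted_bellman hα hα1).1 s hs z hz)) hs f n
  linarith [h n]

lemma optDiscounted_mono {α : ℝ} (hα : 0 ≤ α) (hα1 : α < 1) {s s' : State m} (hs : M.IsState s)
    (hs' : M.IsState s') (hss' : s ≤ s') : M.optDiscounted α s ≤ M.optDiscounted α s' := by
  obtain ⟨f, hf⟩ := M.exists_tendsto_optDiscounted hα hα1 hs'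
  exact M.optDiscounted_le_of_tendsto hα hα1 hs hf (M.discountedCost_mono hα hs hss' f)

lemma exists_bound_optDiscounted_sub :
    ∃ K, ∀ α, 0 ≤ α → α < 1 → ∀ s s', M.IsState s → M.IsState s' →
      |M.optDiscounted α s - M.optDiscounted α s'| ≤ K := by
  obtain ⟨B, _, hB⟩ := M.exists_cost_bound
  have key : ∀ α, 0 ≤ α → α < 1 → ∀ s s', M.IsState s → M.IsState s' →
      M.optDiscounted α s ≤ M.optDiscounted α s' + m * (2 * B) := by
    intro α hα hα1 s s' hs hs'
    obtain ⟨f, hf⟩ := M.exists_tendsto_optDiscounted hα hα1 hs'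
    exact M.optDiscounted_le_of_tendsto hα hα1 hs (hf.add_const _)
      (M.discountedCost_le_add hα hα1.le hB hs hs' f)
  refine ⟨m * (2 * B), fun α hα hα1 s s' hs hs' => abs_le.2 ⟨?_, ?_⟩⟩
  · linarith [key α hα hα1 s' s hs' hs]
  · linarith [key α hα hα1 s s' hs hs']

/-! ### The average cost problem -/

lemma averageCost_eq (s : State m) (f : Sampler M.waitingTimes) :
    M.averageCost s f = limsup (fun n : ℕ => M.discountedCost 1 s f n / n) atTop := by
  simp [averageCost, discountedCost, div_eq_inv_mul]

lemma tendsto_sub_expectedValue_div (W : State m → ℝ) {s : State m} (hs : M.IsState s)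
    (f : Sampler M.waitingTimes) (lam : ℝ) :
    Tendsto (fun n : ℕ => (n * lam + W s - M.expectedValue W s f n) / n) atTop (𝓝 lam) := by
  obtain ⟨B, _, hB⟩ := M.exists_bound_on_states W
  have h0 : Tendsto (fun n : ℕ => ((n : ℝ))⁻¹ * (W s - M.expectedValue W s f n)) atTop (𝓝 0) := by
    refine tendsto_natCast_atTop_atTop.inv_tendsto_atTop.zero_mul_isBoundedUnder_le
      (isBoundedUnder_of ⟨2 * B, fun n => ?_⟩)
    refine (norm_sub_le _ _).trans ?_
    have h1 := hB s hs
    have h2 := M.abs_expectedValue_le hB hs f n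
    simp only [Real.norm_eq_abs]
    linarith
  have h1 := h0.const_add lam
  rw [add_zero] at h1
  refine h1.congr' ?_
  filter_upwards [eventually_gt_atTop 0] with n hn
  have : (n : ℝ) ≠ 0 := by positivity
  field_simp
  ring

lemma averageCost_stationary {lam : ℝ} {h : State m → ℝ} {q : State m → M.waitingTimes}
    (hq : ∀ s, M.IsState s → lam + h s = M.bellman h s (q s)) {s : State m} (hs : M.IsState s) :
    M.averageCost s (stationarySampler q s) = lam := by
  rw [averageCost_eq]
  refine ((M.tendsto_sub_expectedValue_div h hs (stationarySampler q s) lam).congr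
    fun n => ?_).limsup_eq
  have := M.discountedCost_stationary_add (α := 1) (lam := lam) (W := h) (q := q)
    (by simpa only [discountedBellman_one] using hq) hs n
  simp only [one_pow, Finset.sum_const, Finset.card_range, nsmul_eq_mul, mul_one, one_mul] at this
  rw [← this]
  ring

lemma le_averageCost {lam : ℝ} {h : State m → ℝ}
    (hh : ∀ s, M.IsState s → ∀ z ∈ M.waitingTimes, lam + h s ≤ M.bellman h s z)
    {s : State m} (hs : M.IsState s) (f : Sampler M.waitingTimes) :
    lam ≤ M.averageCost s f := by
  have ht := M.tendsto_sub_expectedValue_div h hs f lam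
  rw [averageCost_eq, ← ht.limsup_eq]
  obtain ⟨B, hB0, hB⟩ := M.exists_cost_bound
  refine limsup_le_limsup (Eventually.of_forall fun n => ?_) ht.isCoboundedUnder_le
    (isBoundedUnder_of ⟨B, fun n => ?_⟩)
  · have := M.le_discountedCost_add zero_le_one (lam := lam) (W := h)
      (by simpa only [discountedBellman_one] using hh) hs f n
    simp only [one_pow, Finset.sum_const, Finset.card_range, nsmul_eq_mul, mul_one, one_mul] at this
    simp only
    gcongr
    linarith
  · have := (le_abs_self _).trans (M.abs_discountedCost_le zero_le_one hB hs f n)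
    simp only [one_pow, one_mul, Finset.sum_const, Finset.card_range, nsmul_eq_mul] at this
    exact div_le_of_le_mul₀ n.cast_nonneg hB0 (by linarith)

end System

/-! ### Meromorphic functions to the left of a point -/

/-- A real meromorphic function has constant sign on some interval to the left of a given point. -/
lemma eventually_nonneg_or_nonpos_of_meromorphicAt {f : ℝ → ℝ} {a : ℝ} (hf : MeromorphicAt f a) :
    (∀ᶠ x in 𝓝[<] a, 0 ≤ f x) ∨ ∀ᶠ x in 𝓝[<] a, f x ≤ 0 := by
  have hle : 𝓝[<] a ≤ 𝓝[≠] a := nhdsWithin_mono a fun x hx => ne_of_lt hx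
  by_cases htop : meromorphicOrderAt f a = ⊤
  · left
    filter_upwards [hle (meromorphicOrderAt_eq_top_iff.1 htop)] with x hx using hx.ge
  · obtain ⟨g, hg, hg0, hfg⟩ := (meromorphicOrderAt_ne_top_iff hf).1 htop
    have hlt : ∀ᶠ x in 𝓝[<] a, x - a < 0 := by
      filter_upwards [self_mem_nhdsWithin] with x hx using sub_neg.2 hx
    have hg' := hg.continuousAt.tendsto.mono_left (nhdsWithin_le_nhds (s := Set.Iio a))
    set k := (meromorphicOrderAt f a).untop₀
    rcases lt_or_gt_of_ne hg0 with hs | hs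
    · have hgs := hg'.eventually_lt_const hs
      rcases Int.even_or_odd k with hk | hk
      · right
        filter_upwards [hle hfg, hlt, hgs] with x hx hxa hgx
        rw [hx, smul_eq_mul]
        exact mul_nonpos_of_nonneg_of_nonpos (hk.zpow_nonneg _) hgx.le
      · left
        filter_upwards [hle hfg, hlt, hgs] with x hx hxa hgx
        rw [hx, smul_eq_mul]
        exact mul_nonneg_of_nonpos_of_nonpos (hk.zpow_neg hxa).le hgx.le
    · have hgs := hg'.eventually_const_lt hs
      rcases Int.even_or_odd k with hk | hk
      · left
        filter_upwards [hle hfg, hlt, hgs] with x hx hxa hgx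
        rw [hx, smul_eq_mul]
        exact mul_nonneg (hk.zpow_nonneg _) hgx.le
      · right
        filter_upwards [hle hfg, hlt, hgs] with x hx hxa hgx
        rw [hx, smul_eq_mul]
        exact mul_nonpos_of_nonpos_of_nonneg (hk.zpow_neg hxa).le hgx.le

/-- Among finitely many meromorphic functions one is the smallest immediately to the left of `a`. -/
lemma exists_eventually_le_of_meromorphicAt {ι : Type*} {F : ι → ℝ → ℝ} {a : ℝ}
    (hF : ∀ i, MeromorphicAt (F i) a) {T : Finset ι} (hT : T.Nonempty) :
    ∃ i ∈ T, ∀ j ∈ T, ∀ᶠ x in 𝓝[<] a, F i x ≤ F j x := by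
  classical
  induction hT using Finset.Nonempty.cons_induction with
  | singleton i => exact ⟨i, by simp⟩
  | cons k T hk hT ih =>
    obtain ⟨i, hi, h⟩ := ih
    rcases eventually_nonneg_or_nonpos_of_meromorphicAt ((hF k).sub (hF i)) with hs | hs
    · refine ⟨i, by simp [hi], fun j hj => ?_⟩
      rcases Finset.mem_cons.1 hj with rfl | hj
      · filter_upwards [hs] with x hx using sub_nonneg.1 hx
      · exact h j hj
    · refine ⟨k, by simp, fun j hj => ?_⟩
      rcases Finset.mem_cons.1 hj with rfl | hj
      · exact Eventually.of_forall fun x => le_rfl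
      · filter_upwards [hs, h j hj] with x hx hx' using (sub_nonpos.1 hx).trans hx'

/-- A meromorphic function that is bounded on the left of `a` has no pole at `a`. -/
lemma exists_tendsto_of_meromorphicAt_of_bounded {f : ℝ → ℝ} {a K : ℝ} (hf : MeromorphicAt f a)
    (hK : ∀ᶠ x in 𝓝[<] a, |f x| ≤ K) : ∃ c, Tendsto f (𝓝[<] a) (𝓝 c) := by
  have hle : 𝓝[<] a ≤ 𝓝[≠] a := nhdsWithin_mono a fun x hx => ne_of_lt hx
  rcases lt_or_ge (meromorphicOrderAt f a) 0 with h | h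
  · have h1 := ((tendsto_cobounded_iff_meromorphicOrderAt_neg hf).2 h).mono_left hle
    have h2 := (tendsto_norm_cobounded_atTop.comp h1).eventually_gt_atTop K
    obtain ⟨x, hx1, hx2⟩ := (hK.and h2).exists
    exact absurd hx1 (not_le.2 hx2)
  · obtain ⟨c, hc⟩ := (tendsto_nhds_iff_meromorphicOrderAt_nonneg hf).2 h
    exact ⟨c, hc.mono_left hle⟩

lemma analyticAt_det {n : Type*} [Fintype n] [DecidableEq n] {A : ℝ → Matrix n n ℝ} {a : ℝ}
    (hA : ∀ i j, AnalyticAt ℝ (fun x => A x i j) a) : AnalyticAt ℝ (fun x => (A x).det) a := by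
  simp only [Matrix.det_apply']
  exact Finset.analyticAt_fun_sum _ fun σ _ =>
    analyticAt_const.mul (Finset.analyticAt_fun_prod _ fun i _ => hA _ _)

/-- Cramer's rule: the solution of `v = c + x • P v` is a meromorphic function of `x`. -/
lemma exists_meromorphicAt_resolvent {n : Type*} [Fintype n] [DecidableEq n] (P : Matrix n n ℝ)
    (c : n → ℝ) (a : ℝ) :
    ∃ v : ℝ → n → ℝ, (∀ i, MeromorphicAt (fun x => v x i) a) ∧
      ∀ᶠ x in 𝓝[≠] a, v x = c + x • P.mulVec (v x) := by
  let A : ℝ → Matrix n n ℝ := fun x => 1 - x • P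
  have hA : ∀ i j b, AnalyticAt ℝ (fun x => A x i j) b := by
    intro i j b
    simp only [A, Matrix.sub_apply, Matrix.smul_apply, smul_eq_mul]
    fun_prop
  have hdet : ∀ b, AnalyticAt ℝ (fun x => (A x).det) b := fun b =>
    analyticAt_det fun i j => hA i j b
  have hne : ∀ᶠ x in 𝓝[≠] a, (A x).det ≠ 0 := by
    rcases (hdet a).eventually_eq_zero_or_eventually_ne_zero with h | h
    · -- the determinant equals `1` at `0`, so it does not vanish identically
      have h0 := AnalyticOnNhd.eq_of_eventuallyEq (f := fun x => (A x).det) (g := 0)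
        (fun b _ => hdet b) (fun b _ => analyticAt_const) h
      have := congrFun h0 0
      simp [A] at this
    · exact h
  refine ⟨fun x => (A x).det⁻¹ • (A x).cramer c, fun i => ?_, ?_⟩
  · simp only [Pi.smul_apply, smul_eq_mul, Matrix.cramer_apply]
    refine (hdet a).meromorphicAt.inv.mul (analyticAt_det fun j k => ?_).meromorphicAt
    simp only [Matrix.updateCol_apply]
    split_ifs
    · exact analyticAt_const
    · exact hA _ _ a
  · filter_upwards [hne] with x hx
    have h1 : (A x).mulVec ((A x).det⁻¹ • (A x).cramer c) = c := by
      rw [Matrix.mulVec_smul, Matrix.mulVec_cramer, smul_smul, inv_mul_cancel₀ hx, one_smul]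
    simp only [A, Matrix.sub_mulVec, Matrix.one_mulVec, Matrix.smul_mulVec] at h1 ⊢
    exact sub_eq_iff_eq_add.1 h1

namespace System

variable {Ω : Type*} [MeasurableSpace Ω] {m : ℕ} (M : System Ω m)

/-! ### The vanishing discount limit -/

/-- The discounted cost of a stationary decision rule is meromorphic in the discount factor. -/
lemma exists_meromorphicAt_policyValue (q : {s // M.IsState s} → M.waitingTimes) :
    ∃ V : ℝ → State m → ℝ, (∀ s, M.IsState s → MeromorphicAt (fun α => V α s) 1) ∧
      ∀ᶠ α in 𝓝[<] 1, ∀ s : {s // M.IsState s}, V α s = M.discountedBellman α (V α) s (q s) := by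
  classical
  have : Fintype {s // M.IsState s} := Fintype.ofFinite _
  let X : {s // M.IsState s} → Ω → {s // M.IsState s} :=
    fun s ω => ⟨next s (q s) (M.Y 0 ω), s.2.step (q s).2 (M.Y_mem 0 ω)⟩
  have hX : ∀ s, FiniteValued (X s) := fun s =>
    ⟨Set.toFinite _, fun t => by
      have := ((M.finiteValued_Y 0).comp (next (s : State m) (q s))).2 t
      convert this using 1
      ext ω
      simp [X, Subtype.ext_iff]⟩
  obtain ⟨v, hv, heq⟩ := exists_meromorphicAt_resolvent
    (fun s t => M.μ.real (X s ⁻¹' {t})) (fun s : {s // M.IsState s} => M.cost s (q s)) 1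
  let V : ℝ → State m → ℝ := fun α s => if h : M.IsState s then v α ⟨s, h⟩ else 0
  have hV : ∀ α (s : {s // M.IsState s}), V α s = v α s := fun α s => by simp [V, s.2]
  refine ⟨V, fun s hs => ?_, ?_⟩
  · simpa [V, hs] using hv ⟨s, hs⟩
  · have hle : 𝓝[<] (1 : ℝ) ≤ 𝓝[≠] 1 := nhdsWithin_mono _ fun x hx => ne_of_lt hx
    filter_upwards [hle heq] with α hα s
    have h1 : ∫ ω, V α (next s (q s) (M.Y 0 ω)) ∂M.μ = ∫ ω, v α (X s ω) ∂M.μ :=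
      integral_congr_ae (Eventually.of_forall fun ω => hV α (X s ω))
    rw [hV, congrFun hα s, discountedBellman, h1,
      (hX s).integral_eq_sum (T := Finset.univ) (fun ω => Finset.mem_univ _)]
    rfl

/-- Near `1`, the optimal discounted cost from a given state agrees with that of one stationary
decision rule, hence with a meromorphic function of the discount factor. -/
lemma exists_meromorphicAt_optDiscounted {s : State m} (hs : M.IsState s) :
    ∃ F : ℝ → ℝ, MeromorphicAt F 1 ∧ ∀ᶠ α in 𝓝[<] 1, M.optDiscounted α s = F α := by
  classical
  have : Fintype {s // M.IsState s} := Fintype.ofFinite _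
  choose V hV hVeq using M.exists_meromorphicAt_policyValue
  obtain ⟨q, -, hq⟩ := exists_eventually_le_of_meromorphicAt (F := fun q α => V q α s)
    (fun q => hV q s hs) (T := Finset.univ) ⟨fun _ => ⟨0, M.zero_mem⟩, Finset.mem_univ _⟩
  refine ⟨fun α => V q α s, hV q s hs, ?_⟩
  filter_upwards [eventually_all.2 hVeq, eventually_all.2 fun q' => hq q' (Finset.mem_univ _),
    Ioo_mem_nhdsLT (zero_lt_one' ℝ)] with α h1 h2 hα
  have hlim : ∀ q' : State m → M.waitingTimes,
      Tendsto (M.discountedCost α s (stationarySampler q' s)) atTop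
        (𝓝 (V (fun t => q' t) α s)) := fun q' =>
    M.tendsto_discountedCost_stationary hα.1.le hα.2
      (fun t ht => h1 (fun t => q' t) ⟨t, ht⟩) hs
  obtain ⟨q', hq'⟩ := (M.optDiscounted_bellman hα.1.le hα.2).2
  have hJ : M.optDiscounted α s = V (fun t => q' t) α s :=
    tendsto_nhds_unique (M.tendsto_discountedCost_stationary hα.1.le hα.2 hq' hs) (hlim q')
  refine le_antisymm ?_ (hJ ▸ h2 _)
  let q₀ : State m → M.waitingTimes := fun t =>
    if h : M.IsState t then q ⟨t, h⟩ else ⟨0, M.zero_mem⟩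
  have hq₀ : (fun t : {s // M.IsState s} => q₀ t) = q := by
    funext t
    simp [q₀, t.2]
  have := M.optDiscounted_le_of_tendsto hα.1.le hα.2 hs (hlim q₀) fun n => le_rfl
  rwa [hq₀] at this

lemma exists_isRelativeCost {o : State m} (ho : M.IsState o) : ∃ h, M.IsRelativeCost o h := by
  obtain ⟨K, hK⟩ := M.exists_bound_optDiscounted_sub
  have key : ∀ s, ∃ c, M.IsState s →
      Tendsto (fun α : ℝ => M.optDiscounted α s - M.optDiscounted α o) (𝓝[<] 1) (𝓝 c) := by
    intro s
    by_cases hs : M.IsState s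
    · obtain ⟨F, hF, hFeq⟩ := M.exists_meromorphicAt_optDiscounted hs
      obtain ⟨G, hG, hGeq⟩ := M.exists_meromorphicAt_optDiscounted ho
      obtain ⟨c, hc⟩ := exists_tendsto_of_meromorphicAt_of_bounded (K := K) (hF.sub hG) (by
        filter_upwards [hFeq, hGeq, Ioo_mem_nhdsLT (zero_lt_one' ℝ)] with α h1 h2 hα
        rw [Pi.sub_apply, ← h1, ← h2]
        exact hK α hα.1.le hα.2 s o hs ho)
      refine ⟨c, fun _ => hc.congr' ?_⟩
      filter_upwards [hFeq, hGeq] with α h1 h2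
      rw [Pi.sub_apply, h1, h2]
    · exact ⟨0, fun h => absurd h hs⟩
  choose h hh using key
  exact ⟨h, hh⟩

/-- Bellman's equation of the average cost problem is the limit of the discounted one, with
`lam` the limit of `(1 - α) * optDiscounted α o`. -/
lemma IsRelativeCost.exists_solvesBellman {M : System Ω m} {o : State m} {h : State m → ℝ}
    (hh : M.IsRelativeCost o h) (ho : M.IsState o) : ∃ lam, M.SolvesBellman lam h := by
  have hne : M.waitingTimes.Nonempty := ⟨0, M.zero_mem⟩
  let D : ℝ → State m → ℝ := fun α s => M.optDiscounted α s - M.optDiscounted α o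
  have hIoo : ∀ᶠ α in 𝓝[<] (1 : ℝ), α ∈ Set.Ioo (0 : ℝ) 1 := Ioo_mem_nhdsLT zero_lt_one
  have hlim : ∀ s, M.IsState s → Tendsto
      (fun α => M.waitingTimes.inf' hne fun z => M.discountedBellman α (D α) s z) (𝓝[<] 1)
      (𝓝 (M.waitingTimes.inf' hne (M.bellman h s))) := by
    intro s hs
    refine Filter.Tendsto.finset_inf'_nhds_apply hne fun z hz => ?_
    have h1 : ∀ W : State m → ℝ, ∫ ω, W (next s z (M.Y 0 ω)) ∂M.μ =
        ∑ y ∈ M.serviceTimes, M.μ.real (M.Y 0 ⁻¹' {y}) * W (next s z y) := fun W =>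
      (M.finiteValued_Y 0).integral_eq_sum (M.Y_mem 0) fun y => W (next s z y)
    rw [← discountedBellman_one]
    simp only [discountedBellman, h1]
    exact tendsto_const_nhds.add ((tendsto_nhdsWithin_of_tendsto_nhds tendsto_id).mul
      (tendsto_finsetSum _ fun y hy => (hh _ (hs.step hz hy)).const_mul _))
  have heq : ∀ s, M.IsState s → ∀ᶠ α in 𝓝[<] (1 : ℝ), D α s + (1 - α) * M.optDiscounted α o =
      M.waitingTimes.inf' hne fun z => M.discountedBellman α (D α) s z := by
    intro s hs
    filter_upwards [hIoo] with α hα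
    have hD : ∀ z, M.discountedBellman α (D α) s z =
        M.discountedBellman α (M.optDiscounted α) s z - α * M.optDiscounted α o := by
      intro z
      simp only [discountedBellman, D]
      rw [integral_sub (M.integrable_comp_Y fun y => M.optDiscounted α (next s z y))
        (integrable_const _)]
      simp only [integral_const, probReal_univ, one_smul]
      ring
    obtain ⟨hle, q, hq⟩ := M.optDiscounted_bellman hα.1.le hα.2
    refine le_antisymm (Finset.le_inf' _ _ fun z hz => ?_)
      ((Finset.inf'_le _ (q s).2).trans_eq ?_)
    · rw [hD]
      simp only [D]
      linarith [hle s hs z hz]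
    · rw [hD, ← hq s hs]
      simp only [D]
      ring
  have hlam : Tendsto (fun α => (1 - α) * M.optDiscounted α o) (𝓝[<] 1)
      (𝓝 (M.waitingTimes.inf' hne (M.bellman h o))) := by
    refine (hlim o ho).congr' ?_
    filter_upwards [heq o ho] with α hα
    rw [← hα]
    simp [D]
  refine ⟨M.waitingTimes.inf' hne (M.bellman h o), fun s hs => ?_⟩
  have h1 : M.waitingTimes.inf' hne (M.bellman h o) + h s =
      M.waitingTimes.inf' hne (M.bellman h s) := by
    rw [add_comm]
    exact tendsto_nhds_unique_of_eventuallyEq ((hh s hs).add hlam) (hlim s hs) (heq s hs)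
  rw [h1]
  obtain ⟨z, hz, hzeq⟩ := Finset.exists_mem_eq_inf' hne (M.bellman h s)
  refine ⟨⟨z, hz, hzeq.symm⟩, ?_⟩
  rintro _ ⟨z', hz', rfl⟩
  exact Finset.inf'_le _ hz'

lemma IsRelativeCost.mono {M : System Ω m} {o : State m} {h : State m → ℝ}
    (hh : M.IsRelativeCost o h) {s s' : State m} (hs : M.IsState s) (hs' : M.IsState s')
    (hss' : s ≤ s') : h s ≤ h s' := by
  refine le_of_tendsto_of_tendsto (hh s hs) (hh s' hs') ?_
  filter_upwards [Ioo_mem_nhdsLT (zero_lt_one' ℝ)] with α hα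
  exact sub_le_sub_right (M.optDiscounted_mono hα.1.le hα.2 hs hs' hss') _

/-! ### The threshold rule -/

lemma IsRelativeCost.isOptimalWait_zero {M : System Ω m} {o : State m} {h : State m → ℝ}
    (hh : M.IsRelativeCost o h) {s : State m} (hs : M.IsState s) (hp : M.PassesThreshold s) :
    M.IsOptimalWait h s 0 := by
  refine ⟨M.zero_mem, fun z hz => ?_⟩
  have hz0 := M.waiting_nonneg z hz
  refine add_le_add (M.cost_zero_le hs.nonneg hp hz0) (integral_mono
    (M.integrable_comp_Y fun y => h (next s 0 y)) (M.integrable_comp_Y fun y => h (next s z y))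
    fun ω => ?_)
  exact hh.mono (hs.step M.zero_mem (M.Y_mem 0 ω)) (hs.step hz (M.Y_mem 0 ω))
    (next_mono le_rfl hz0 _)

end System

end StatusUpdate

theorem proposition3 {Ω : Type*} [MeasurableSpace Ω] {m : ℕ} (M : StatusUpdate.System Ω m)
    (o : StatusUpdate.State m) (ho : M.IsState o) :
    ∃ (lam : ℝ) (h : StatusUpdate.State m → ℝ),
      M.IsRelativeCost o h ∧
      M.SolvesBellman lam h ∧
      (∀ s, M.IsState s → M.PassesThreshold s → M.IsOptimalWait h s 0) ∧
      ∃ q : StatusUpdate.State m → M.waitingTimes,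
        (∀ s, M.IsState s → M.IsOptimalWait h s (q s)) ∧
        (∀ s, M.IsState s → M.PassesThreshold s → (q s : ℝ) = 0) ∧
        ∀ s, M.IsState s → M.IsAverageOptimal s (StatusUpdate.stationarySampler q s) := by
  classical
  obtain ⟨h, hh⟩ := M.exists_isRelativeCost ho
  obtain ⟨lam, hlam⟩ := hh.exists_solvesBellman ho
  have hzero : ∀ s, M.IsState s → M.PassesThreshold s → M.IsOptimalWait h s 0 :=
    fun s hs hp => hh.isOptimalWait_zero hs hp
  have hq : ∀ s, ∃ z : M.waitingTimes, M.IsState s →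
      M.IsOptimalWait h s z ∧ (M.PassesThreshold s → (z : ℝ) = 0) := by
    intro s
    by_cases hp : M.PassesThreshold s
    · exact ⟨⟨0, M.zero_mem⟩, fun hs => ⟨hzero s hs hp, fun _ => rfl⟩⟩
    · obtain ⟨z, hz, hle⟩ := M.waitingTimes.exists_min_image (M.bellman h s) ⟨0, M.zero_mem⟩
      exact ⟨⟨z, hz⟩, fun _ => ⟨⟨hz, hle⟩, fun h => absurd h hp⟩⟩
  choose q hq using hq
  refine ⟨lam, h, hh, hlam, hzero, q, fun s hs => (hq s hs).1, fun s hs => (hq s hs).2,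
    fun s hs f => ?_⟩
  have hatt : ∀ s, M.IsState s → lam + h s = M.bellman h s (q s) := by
    intro s hs
    obtain ⟨⟨z, hz, hzeq⟩, hle⟩ := hlam s hs
    exact le_antisymm (hle ⟨_, (q s).2, rfl⟩) (hzeq ▸ (hq s hs).1.2 z hz)
  rw [M.averageCost_stationary hatt hs]
  exact M.le_averageCost (fun s hs z hz => (hlam s hs).2 ⟨z, hz, rfl⟩) hs f
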